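/- Let $q,t,z$ be indeterminates, put $(q;q)_n=\prod_{i=1}^n(1-q^i)$ and $e(z;q)=\sum_{n\ge0}\frac{z^n}{(q;q)_n}$, and let ${n\brack k}_q=\frac{(q;q)_n}{(q;q)_{n-k}(q;q)_k}$ for $0\le k\le n$ and ${n\brack k}_q=0$ for $k<0$ or $k>n$. Define the $q$-Eulerian polynomials $A_n(t,q)$ by $$\sum_{n\ge0}A_n(t,q)\frac{z^n}{(q;q)_n}=\frac{(1-t)\,e(z;q)}{e(tz;q)-t\,e(z;q)},$$ and, for $1\le j\le n$, the restricted $q$-Eulerian polynomials $B_n^{(j)}(t,q)$ and the restricted $q$-Eulerian numbers $B_{n,k}^{(j)}(q)$ by $$\sum_{n\ge j}B_n^{(j)}(t,q)\frac{z^{n-1}}{(q;q)_{n-1}}=\frac{A_{j-1}(t,q)\,(qz)^{j-1}}{(q;q)_{j-1}}\cdot\frac{e(tz;q)-t\,e(tz;q)}{e(tz;q)-t\,e(z;q)},\qquad B_n^{(j)}(t,q)=\sum_kB_{n,k}^{(j)}(q)\,t^k,$$ with $B_{n,k}^{(j)}(q)=0$ for $n<j$. Theorem. Let $a,b,j$ be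 integers with $a,b\ge1$ and $j\ge2$. Then $$\sum_{k\ge1}{a+b+1\brack k-1}_qB_{k,a}^{(j)}(q)=\sum_{k\ge1}{a+b+1\brack k-1}_qB_{k,b}^{(j)}(q).$$ -/

import Mathlib

open PowerSeries

/-- The `q`-shifted factorial `(q;q)_n = ∏_{i=1}^{n} (1 - q^i)`. -/
def qPoch {K : Type*} [Field K] (q : K) (n : ℕ) : K :=
  ∏ i ∈ Finset.Icc 1 n, (1 - q ^ i)

/-- The `q`-binomial coefficient `(q;q)_n / ((q;q)_{n-k} (q;q)_k)` for `0 ≤ k ≤ n`, and `0` for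
`k > n`. -/
def qBinom {K : Type*} [Field K] (q : K) (n k : ℕ) : K :=
  if k ≤ n then qPoch q n / (qPoch q (n - k) * qPoch q k) else 0

/-- The series `e(uz;q) = ∑_{n ≥ 0} (uz)^n / (q;q)_n`. It lives in `K⟦t⟧⟦z⟧`: the variable of the
inner power series ring is `t`, the variable of the outer one is `z`. -/
noncomputable def qExp {K : Type*} [Field K] (q : K) (u : K⟦X⟧) : K⟦X⟧⟦X⟧ :=
  PowerSeries.mk fun n => u ^ n * C (qPoch q n)⁻¹

/-- The common denominator `e(tz;q) - t e(z;q)`. -/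
noncomputable def eulerianDenom {K : Type*} [Field K] (q : K) : K⟦X⟧⟦X⟧ :=
  qExp q X - C (X : K⟦X⟧) * qExp q 1

/-- The denominator is invertible in `K⟦t⟧⟦z⟧`: its constant term in `z` is `1 - t`. -/
theorem isUnit_eulerianDenom {K : Type*} [Field K] (q : K) : IsUnit (eulerianDenom q) := by
  rw [PowerSeries.isUnit_iff_constantCoeff, PowerSeries.isUnit_iff_constantCoeff]
  have h : ∀ u : K⟦X⟧, constantCoeff (qExp q u) = 1 := fun u => by
    rw [← PowerSeries.coeff_zero_eq_constantCoeff_apply, qExp, PowerSeries.coeff_mk]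
    simp [qPoch]
  simp [eulerianDenom, h]

/-- The inverse series `1 / (e(tz;q) - t e(z;q))` in `K⟦t⟧⟦z⟧`. -/
noncomputable def eulerianDenomInv {K : Type*} [Field K] (q : K) : K⟦X⟧⟦X⟧ :=
  ((isUnit_eulerianDenom q).unit⁻¹ : (K⟦X⟧⟦X⟧)ˣ)

/-- `A_n(t,r,q)`, as a series in `t`: it is defined by
`∑_{n ≥ 0} A_n(t,r,q) z^n / (q;q)_n = (1 - t) e(rz;q) / (e(tz;q) - t e(z;q))`. -/
noncomputable def qrEulerian {K : Type*} [Field K] (q r : K) (n : ℕ) : K⟦X⟧ :=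
  C (qPoch q n) *
    coeff n (C (1 - X : K⟦X⟧) * qExp q (C r) * eulerianDenomInv q)

/-- `A_n(t,q) = A_n(t,1,q)`. -/
noncomputable def qEulerian {K : Type*} [Field K] (q : K) (n : ℕ) : K⟦X⟧ :=
  qrEulerian q 1 n

/-- The series
`(A_{j-1}(t,q) (qz)^{j-1} / (q;q)_{j-1}) * (e(tz;q) - t e(tz;q)) / (e(tz;q) - t e(z;q))`,
for `j ≥ 1`. -/
noncomputable def restrictedGF {K : Type*} [Field K] (q : K) (j : ℕ) : K⟦X⟧⟦X⟧ :=
  C (qEulerian q (j - 1)) * (C (C q) * X) ^ (j - 1) * C (C (qPoch q (j - 1))⁻¹) *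
    (qExp q X - C (X : K⟦X⟧) * qExp q X) * eulerianDenomInv q

/-- The restricted `q`-Eulerian polynomial `B_n^{(j)}(t,q)`, as a series in `t`, for `n ≥ 1` and
`j ≥ 1`: `(q;q)_{n-1}` times the coefficient of `z^{n-1}` in `restrictedGF q j`. It vanishes for
`1 ≤ n < j`, since that series is divisible by `z^{j-1}`; the value at `n = 0` is set to `0`. -/
noncomputable def restrictedQEulerian {K : Type*} [Field K] (q : K) (j : ℕ) : ℕ → K⟦X⟧
  | 0 => 0
  | m + 1 => C (qPoch q m) * coeff m (restrictedGF q j)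

/-- The restricted `q`-Eulerian number `B_{n,k}^{(j)}(q)`: the coefficient of `t^k` in
`B_n^{(j)}(t,q)`. -/
noncomputable def restrictedQEulerianNumber {K : Type*} [Field K] (q : K) (j n k : ℕ) : K :=
  coeff k (restrictedQEulerian q j n)

/-! With `N = a + b + 1`, each side is `(q;q)_N` times a coefficient, of `t^a` or `t^b`, in the
`z^N` term of the restricted generating function times `e(z;q)`
(`sum_qBinom_mul_restrictedQEulerianNumber`). It is enough that this term is palindromic in `t` of
degree `N - 1 = a + b`.

Up to a constant the product is `z^(j-1) A_{j-1} · e(tz)e(z) · (1-t)/(e(tz) - t e(z))`. In the last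
two factors the coefficient of `z^n` is palindromic of degree `n`: the first is visibly symmetric,
and the second equals `1/(1-S)` with `S = innerGeomSeries q`. For `j ≥ 2`, `A_{j-1}` is palindromic
of degree `j - 2`, which accounts for the drop from `N` to `N - 1`. -/

/-! ### Palindromic polynomials in `t` -/

/-- The power series that are polynomials of degree at most `d` with `p(t) = t^d p(1/t)`. -/
def palindromic (K : Type*) [Field K] (d : ℕ) : Submodule K K⟦X⟧ where
  carrier := {p | (∀ i j, i + j = d → coeff i p = coeff j p) ∧ ∀ i, d < i → coeff i p = 0}
  add_mem' := fun {p r} hp hr =>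
    ⟨fun i j h => by rw [map_add, map_add, hp.1 i j h, hr.1 i j h],
      fun i h => by rw [map_add, hp.2 i h, hr.2 i h, add_zero]⟩
  zero_mem' := ⟨fun _ _ _ => by simp, fun _ _ => by simp⟩
  smul_mem' := fun c p hp =>
    ⟨fun i j h => by simp [hp.1 i j h], fun i h => by simp [hp.2 i h]⟩

theorem C_mul_mem_palindromic {K : Type*} [Field K] {d : ℕ} (c : K) {p : K⟦X⟧}
    (hp : p ∈ palindromic K d) : C c * p ∈ palindromic K d := by
  rw [← PowerSeries.smul_eq_C_mul]
  exact Submodule.smul_mem _ c hp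

/-- Passes to polynomials so that `Polynomial.reflect_mul` can give closure under products. -/
theorem exists_reflect_eq_of_mem_palindromic {K : Type*} [Field K] {d : ℕ} {p : K⟦X⟧}
    (hp : p ∈ palindromic K d) :
    ∃ P : Polynomial K, P.natDegree ≤ d ∧ P.reflect d = P ∧ (P : K⟦X⟧) = p := by
  have hco : (trunc (d + 1) p : K⟦X⟧) = p := by
    ext i
    rw [Polynomial.coeff_coe, coeff_trunc]
    split_ifs with h
    · rfl
    · exact (hp.2 i (by omega)).symm
  have hcoeff : ∀ i, (trunc (d + 1) p).coeff i = coeff i p := fun i => by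
    rw [← Polynomial.coeff_coe, hco]
  refine ⟨trunc (d + 1) p, Nat.lt_succ_iff.mp (natDegree_trunc_lt p d), ?_, hco⟩
  ext i
  rw [Polynomial.coeff_reflect, hcoeff, hcoeff]
  rcases le_or_gt i d with h | h
  · rw [Polynomial.revAt_le h]
    exact hp.1 _ _ (by omega)
  · rw [Polynomial.revAt_eq_self_of_lt h]

theorem coe_mem_palindromic {K : Type*} [Field K] {d : ℕ} {P : Polynomial K}
    (hdeg : P.natDegree ≤ d) (hP : P.reflect d = P) : (P : K⟦X⟧) ∈ palindromic K d := by
  refine ⟨fun i j h => ?_, fun i h => ?_⟩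
  · rw [Polynomial.coeff_coe, Polynomial.coeff_coe]
    conv_lhs => rw [← hP]
    rw [Polynomial.coeff_reflect, Polynomial.revAt_le (by omega)]
    congr 1
    omega
  · rw [Polynomial.coeff_coe]
    exact Polynomial.coeff_eq_zero_of_natDegree_lt (by omega)

theorem mul_mem_palindromic {K : Type*} [Field K] {d e : ℕ} {p r : K⟦X⟧}
    (hp : p ∈ palindromic K d) (hr : r ∈ palindromic K e) : p * r ∈ palindromic K (d + e) := by
  obtain ⟨P, hPd, hPr, rfl⟩ := exists_reflect_eq_of_mem_palindromic hp
  obtain ⟨R, hRd, hRr, rfl⟩ := exists_reflect_eq_of_mem_palindromic hr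
  rw [← Polynomial.coe_mul]
  refine coe_mem_palindromic (Polynomial.natDegree_mul_le.trans (by omega)) ?_
  rw [Polynomial.reflect_mul P R hPd hRd, hPr, hRr]

theorem coeff_sum_range_X_pow {K : Type*} [Field K] (n m : ℕ) :
    coeff m (∑ i ∈ Finset.range n, (X : K⟦X⟧) ^ i) = if m < n then 1 else 0 := by
  simp [map_sum, coeff_X_pow]

theorem geom_sum_mem_palindromic {K : Type*} [Field K] (n : ℕ) :
    ∑ i ∈ Finset.range (n + 1), (X : K⟦X⟧) ^ i ∈ palindromic K n := by
  refine ⟨fun i j h => ?_, fun i h => ?_⟩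
  · rw [coeff_sum_range_X_pow, coeff_sum_range_X_pow, if_pos (by omega), if_pos (by omega)]
  · rw [coeff_sum_range_X_pow, if_neg (by omega)]

/-- The degree is 2 because the centre of symmetry `d/2` has to be the exponent 1. -/
theorem X_mem_palindromic {K : Type*} [Field K] : (X : K⟦X⟧) ∈ palindromic K 2 := by
  refine ⟨fun i j h => ?_, fun i h => ?_⟩
  · rw [coeff_X, coeff_X]
    congr 1
    exact propext (by omega)
  · rw [coeff_X, if_neg (by omega)]

/-! ### Graded palindromic series in `z` -/

/-- The series in `z` whose coefficient of `z^n` is palindromic of degree `n` for every `n`. -/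
def GradedPalindromic {K : Type*} [Field K] (F : K⟦X⟧⟦X⟧) : Prop :=
  ∀ n, coeff n F ∈ palindromic K n

theorem GradedPalindromic.mul {K : Type*} [Field K] {F G : K⟦X⟧⟦X⟧}
    (hF : GradedPalindromic F) (hG : GradedPalindromic G) : GradedPalindromic (F * G) := by
  intro n
  rw [coeff_mul]
  refine Submodule.sum_mem _ fun x hx => ?_
  rw [← Finset.HasAntidiagonal.mem_antidiagonal.mp hx]
  exact mul_mem_palindromic (hF _) (hG _)

theorem GradedPalindromic.one {K : Type*} [Field K] :
    GradedPalindromic (1 : K⟦X⟧⟦X⟧) := by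
  intro n
  rw [coeff_one]
  split_ifs with h
  · subst h
    simpa using geom_sum_mem_palindromic (K := K) 0
  · exact Submodule.zero_mem _

/-- Since `V = 1 + S V` and `S` has no constant term, each coefficient of `V` is determined by
earlier ones. -/
theorem GradedPalindromic.of_one_sub_mul_eq_one {K : Type*} [Field K] {S V : K⟦X⟧⟦X⟧}
    (hS : GradedPalindromic S) (hS0 : coeff 0 S = 0) (h : (1 - S) * V = 1) :
    GradedPalindromic V := by
  intro n
  induction n using Nat.strong_induction_on with
  | _ n ih =>
    have hV : V = 1 + S * V := by linear_combination h
    rw [hV, map_add, coeff_mul]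
    refine Submodule.add_mem _ (GradedPalindromic.one n) (Submodule.sum_mem _ fun x hx => ?_)
    have hx' := Finset.HasAntidiagonal.mem_antidiagonal.mp hx
    rcases Nat.eq_zero_or_pos x.1 with h0 | h0
    · rw [h0, hS0, zero_mul]
      exact Submodule.zero_mem _
    · rw [← hx']
      exact mul_mem_palindromic (hS _) (ih _ (by omega))

/-! ### Symmetry of the Eulerian generating functions -/

/-- The series `∑_{n ≥ 2} (t + ⋯ + t^{n-1}) z^n / (q;q)_n`. -/
noncomputable def innerGeomSeries {K : Type*} [Field K] (q : K) : K⟦X⟧⟦X⟧ :=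
  PowerSeries.mk fun n => C (qPoch q n)⁻¹ * (X * ∑ i ∈ Finset.range (n - 1), X ^ i)

/-- The series `∑_{n ≥ 0} (1 + t + ⋯ + t^n) z^n / (q;q)_{n+1}`. -/
noncomputable def geomSeries {K : Type*} [Field K] (q : K) : K⟦X⟧⟦X⟧ :=
  PowerSeries.mk fun n => C (qPoch q (n + 1))⁻¹ * ∑ i ∈ Finset.range (n + 1), X ^ i

theorem gradedPalindromic_innerGeomSeries {K : Type*} [Field K] (q : K) :
    GradedPalindromic (innerGeomSeries q) := by
  intro n
  rw [innerGeomSeries, coeff_mk]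
  refine C_mul_mem_palindromic _ ?_
  rcases n with _ | _ | n
  · simp
  · simp
  · have h := mul_mem_palindromic (X_mem_palindromic (K := K)) (geom_sum_mem_palindromic n)
    rwa [add_comm 2 n] at h

theorem gradedPalindromic_geomSeries {K : Type*} [Field K] (q : K) :
    GradedPalindromic (geomSeries q) := fun n => by
  rw [geomSeries, coeff_mk]
  exact C_mul_mem_palindromic _ (geom_sum_mem_palindromic n)

theorem gradedPalindromic_qExp_mul_qExp {K : Type*} [Field K] (q : K) :
    GradedPalindromic (qExp q X * qExp q 1) := by
  -- This closed form is invariant under `m ↔ n - m`.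
  have key : ∀ n m, coeff m (coeff n (qExp q X * qExp q 1)) =
      if m ≤ n then (qPoch q m)⁻¹ * (qPoch q (n - m))⁻¹ else 0 := by
    intro n m
    rw [coeff_mul, Finset.Nat.sum_antidiagonal_eq_sum_range_succ
      (fun i j => coeff i (qExp q X) * coeff j (qExp q (1 : K⟦X⟧))), map_sum]
    have : ∀ i, coeff m (coeff i (qExp q X) * coeff (n - i) (qExp q (1 : K⟦X⟧))) =
        if m = i then (qPoch q i)⁻¹ * (qPoch q (n - i))⁻¹ else 0 := by
      intro i
      rw [qExp, qExp, coeff_mk, coeff_mk, one_pow, one_mul, mul_assoc, ← map_mul, coeff_mul_C,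
        coeff_X_pow]
      split_ifs <;> simp
    simp only [this, Finset.sum_ite_eq, Finset.mem_range, Nat.lt_succ_iff]
  intro n
  refine ⟨fun i j h => ?_, fun i h => ?_⟩
  · rw [key, key, if_pos (by omega), if_pos (by omega), mul_comm]
    congr <;> omega
  · rw [key, if_neg (by omega)]

/-- Termwise, `t - t^n = (1-t)(t + ⋯ + t^{n-1})` for `n ≥ 1`. -/
theorem eulerianDenom_eq {K : Type*} [Field K] (q : K) :
    eulerianDenom q = C (1 - X : K⟦X⟧) * (1 - innerGeomSeries q) := by
  ext1 n
  rw [eulerianDenom, qExp, qExp, innerGeomSeries, map_sub, coeff_C_mul, coeff_C_mul, map_sub,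
    coeff_mk, coeff_mk, coeff_mk, coeff_one]
  rcases n with _ | n
  · simp [qPoch]
  · have h := mul_neg_geom_sum (X : K⟦X⟧) n
    rw [if_neg (Nat.succ_ne_zero n), Nat.add_sub_cancel, one_pow, pow_succ]
    linear_combination X * C (qPoch q (n + 1))⁻¹ * h

theorem qExp_one_eq {K : Type*} [Field K] (q : K) :
    qExp q (1 : K⟦X⟧) = (1 - innerGeomSeries q) + X * geomSeries q := by
  ext1 n
  rw [qExp, innerGeomSeries, geomSeries, map_add, map_sub, coeff_mk, coeff_mk, coeff_one]
  rcases n with _ | n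
  · simp [qPoch]
  · rw [coeff_succ_X_mul, coeff_mk, if_neg (Nat.succ_ne_zero n), Nat.add_sub_cancel, one_pow,
      Finset.sum_range_succ', Finset.mul_sum]
    simp only [pow_succ']
    rw [pow_zero]
    ring

theorem one_sub_innerGeomSeries_mul {K : Type*} [Field K] (q : K) :
    (1 - innerGeomSeries q) * (C (1 - X : K⟦X⟧) * eulerianDenomInv q) = 1 := by
  have h : eulerianDenom q * eulerianDenomInv q = 1 := (isUnit_eulerianDenom q).mul_val_inv
  rw [eulerianDenom_eq] at h
  linear_combination h

theorem gradedPalindromic_eulerianDenomInv {K : Type*} [Field K] (q : K) :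
    GradedPalindromic (C (1 - X : K⟦X⟧) * eulerianDenomInv q) :=
  (gradedPalindromic_innerGeomSeries q).of_one_sub_mul_eq_one
    (by simp [innerGeomSeries]) (one_sub_innerGeomSeries_mul q)

theorem qEulerian_succ_mem_palindromic {K : Type*} [Field K] (q : K) (n : ℕ) :
    qEulerian q (n + 1) ∈ palindromic K n := by
  -- The factor `X` here is `z`; it lowers the degree of symmetry from `n + 1` to `n`.
  have h : C (1 - X : K⟦X⟧) * qExp q (C 1) * eulerianDenomInv q =
      1 + X * (geomSeries q * (C (1 - X : K⟦X⟧) * eulerianDenomInv q)) := by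
    rw [map_one, qExp_one_eq]
    linear_combination one_sub_innerGeomSeries_mul q
  rw [qEulerian, qrEulerian, h, map_add, coeff_one, if_neg (Nat.succ_ne_zero n), zero_add,
    coeff_succ_X_mul]
  exact C_mul_mem_palindromic _
    ((gradedPalindromic_geomSeries q).mul (gradedPalindromic_eulerianDenomInv q) n)

theorem coeff_restrictedGF_mul_qExp_mem_palindromic {K : Type*} [Field K] (q : K) (j N : ℕ) :
    coeff (N + 1) (restrictedGF q (j + 2) * qExp q 1) ∈ palindromic K N := by
  have h : restrictedGF q (j + 2) * qExp q 1 =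
      X ^ (j + 1) * (C (C (q ^ (j + 1) * (qPoch q (j + 1))⁻¹) * qEulerian q (j + 1)) *
        (qExp q X * qExp q 1 * (C (1 - X : K⟦X⟧) * eulerianDenomInv q))) := by
    rw [restrictedGF, show j + 2 - 1 = j + 1 from rfl]
    simp only [map_mul, map_sub, map_one, map_pow]
    ring
  rw [h, coeff_X_pow_mul']
  split_ifs with hN
  -- Degree `j` comes from the Eulerian polynomial, the rest from the graded factor.
  · have hd : N = j + (N + 1 - (j + 1)) := by omega
    rw [coeff_C_mul]
    have := mul_mem_palindromic (C_mul_mem_palindromic (q ^ (j + 1) * (qPoch q (j + 1))⁻¹)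
      (qEulerian_succ_mem_palindromic q j))
      ((gradedPalindromic_qExp_mul_qExp q).mul (gradedPalindromic_eulerianDenomInv q)
        (N + 1 - (j + 1)))
    rwa [← hd] at this
  · exact Submodule.zero_mem _

/-! ### The sums as coefficients, and the conclusion -/

theorem sum_qBinom_mul_restrictedQEulerianNumber {K : Type*} [Field K] (q : K)
    (hq : ∀ n, qPoch q n ≠ 0) (j N a : ℕ) :
    ∑ k ∈ Finset.Icc 1 (N + 1), qBinom q N (k - 1) * restrictedQEulerianNumber q j k a =
      qPoch q N * coeff a (coeff N (restrictedGF q j * qExp q 1)) := by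
  rw [coeff_mul, Finset.Nat.sum_antidiagonal_eq_sum_range_succ
    (fun i l => coeff i (restrictedGF q j) * coeff l (qExp q (1 : K⟦X⟧))), map_sum,
    Finset.mul_sum, Finset.range_eq_Ico]
  -- The shift `k = m + 1` matches `B_k` with the coefficient of `z^(k-1)`.
  refine (Finset.sum_Ico_add' (fun k => qBinom q N (k - 1) * restrictedQEulerianNumber q j k a)
    0 (N + 1) 1).symm.trans ?_
  refine Finset.sum_congr rfl fun m hm => ?_
  have hm' : m ≤ N := Nat.lt_succ_iff.mp (Finset.mem_Ico.mp hm).2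
  rw [Nat.add_sub_cancel, restrictedQEulerianNumber, restrictedQEulerian, qBinom, if_pos hm',
    qExp, coeff_mk, one_pow, one_mul, coeff_C_mul, coeff_mul_C]
  have h1 := hq m
  have h2 := hq (N - m)
  field_simp

theorem qPoch_ratFuncX_ne_zero (n : ℕ) : qPoch (RatFunc.X : RatFunc ℚ) n ≠ 0 := by
  refine Finset.prod_ne_zero_iff.mpr fun i hi h => ?_
  have hi' : i ≠ 0 := by
    have := (Finset.mem_Icc.mp hi).1
    omega
  -- A vanishing factor `1 - q^i` would be an identity between polynomials of different degrees.
  have hX : (Polynomial.X ^ i : Polynomial ℚ) = 1 := by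
    apply RatFunc.algebraMap_injective ℚ
    rw [map_pow, RatFunc.algebraMap_X, map_one]
    exact (sub_eq_zero.mp h).symm
  have hdeg := congrArg Polynomial.natDegree hX
  rw [Polynomial.natDegree_X_pow, Polynomial.natDegree_one] at hdeg
  exact hi' hdeg

theorem theorem1 (a b j : ℕ) (ha : 1 ≤ a) (hb : 1 ≤ b) (hj : 2 ≤ j) :
    ∑ k ∈ Finset.Icc 1 (a + b + 2),
        qBinom (RatFunc.X : RatFunc ℚ) (a + b + 1) (k - 1) *
          restrictedQEulerianNumber (RatFunc.X : RatFunc ℚ) j k a =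
      ∑ k ∈ Finset.Icc 1 (a + b + 2),
        qBinom (RatFunc.X : RatFunc ℚ) (a + b + 1) (k - 1) *
          restrictedQEulerianNumber (RatFunc.X : RatFunc ℚ) j k b := by
  obtain ⟨i, rfl⟩ := Nat.exists_eq_add_of_le' hj
  have hq := qPoch_ratFuncX_ne_zero
  rw [sum_qBinom_mul_restrictedQEulerianNumber _ hq _ (a + b + 1) a,
    sum_qBinom_mul_restrictedQEulerianNumber _ hq _ (a + b + 1) b,
    (coeff_restrictedGF_mul_qExp_mem_palindromic _ i (a + b)).1 a b rfl]
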